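/- Let $k$ be a positive integer and $S_k$ the symmetric group on $\{1,\dots,k\}$. On complex-valued functions on $S_k$ consider the convolution $(f_1*f_2)(\pi)=\sum_{\tau\in S_k}f_1(\tau)f_2(\tau^{-1}\pi)$. Let $\kappa(\pi)$ be the number of cycles of $\pi$ (fixed points included). For $z\in\mathbb{C}$ let $\mathrm{Wg}^U(\cdot;z)$ be the unitary Weingarten function, i.e. the pseudo-inverse of $z^{\kappa(\cdot)}$ in the centre of the convolution algebra: the unique central function $w$ with $z^{\kappa(\cdot)}*w*z^{\kappa(\cdot)}=z^{\kappa(\cdot)}$ and $w*z^{\kappa(\cdot)}*w=w$. The double Weingarten function is $\mathrm{Wg}^U(\cdot;z,w)=\mathrm{Wg}^U(\cdot;z)*\mathrm{Wg}^U(\cdot;w)$. For sequences $\mathbf a=(a_1,\dots,a_k)$, $\mathbf a'=(a'_1,\dots,a'_k)$ and $\sigma\in S_k$ put $\delta_\sigma(\mathbf a,\mathbf a')=\prod_{s=1}^k\delta_{a_{\sigma(s)},a'_s}$, and for a square matrix $A$ and $\pi\in S_k$ of cycle-type $(\mu_1,\dots,\mu_l)$ put $\mathrm{Tr}_\pi(A)=\prod_{r=1}^l\mathrm{Tr}(A^{\mu_r})$.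 **Theorem.** Let $X=(x_{ij})$ be an $n\times p$ complex random matrix that has the same distribution as $UXV$ for all unitary matrices $U$ (of size $n\times n$) and $V$ (of size $p\times p$), and whose entries have finite absolute moments of order $2k$. Then for all sequences $\mathbf i=(i_1,\dots,i_k)$, $\mathbf i'=(i'_1,\dots,i'_k)$ in $\{1,\dots,n\}$ and $\mathbf j=(j_1,\dots,j_k)$, $\mathbf j'=(j'_1,\dots,j'_k)$ in $\{1,\dots,p\}$, $$E\big[x_{i_1j_1}\cdots x_{i_kj_k}\,\overline{x_{i'_1j'_1}\cdots x_{i'_kj'_k}}\big]=\sum_{\sigma_1,\sigma_2,\pi\in S_k}\delta_{\sigma_1}(\mathbf i,\mathbf i')\,\delta_{\sigma_2}(\mathbf j,\mathbf j')\,\mathrm{Wg}^U(\pi\sigma_1^{-1}\sigma_2;n,p)\,E[\mathrm{Tr}_\pi(XX^*)].$$ -/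

import Mathlib

noncomputable section

namespace UnitaryWeingarten

open scoped ComplexConjugate

/-! ## The convolution algebra of complex functions on a finite group -/

section Convolution

variable {G : Type*} [Group G]

/-- The adjoint `f*(x) = conj (f (x⁻¹))`. -/
def adj (f : G → ℂ) : G → ℂ := fun x => conj (f x⁻¹)

theorem adj_adj (f : G → ℂ) : adj (adj f) = f := by
  funext x
  simp [adj]

variable [Fintype G]

/-- Convolution of complex functions on a finite group:
`(f₁ * f₂)(x) = ∑ t, f₁(t) f₂(t⁻¹ x)`. -/
def conv (f₁ f₂ : G → ℂ) : G → ℂ :=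
  fun x => ∑ t : G, f₁ t * f₂ (t⁻¹ * x)

/-- Membership in the centre of the convolution algebra. -/
def IsCentral (f : G → ℂ) : Prop :=
  ∀ g : G → ℂ, conv f g = conv g f

/-- `b` is a pseudo-inverse of `a` in the centre of the convolution algebra:
`b` is central, `a * b * a = a` and `b * a * b = b`. -/
def IsCentralPseudoInverse (a b : G → ℂ) : Prop :=
  IsCentral b ∧ conv (conv a b) a = a ∧ conv (conv b a) b = b

theorem conv_assoc (f g h : G → ℂ) : conv (conv f g) h = conv f (conv g h) := by
  funext x
  simp only [conv, Finset.sum_mul, Finset.mul_sum]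
  rw [Finset.sum_comm]
  refine Finset.sum_congr rfl fun s _ => ?_
  refine Fintype.sum_equiv (Equiv.mulLeft s⁻¹) _ _ fun t => ?_
  simp [mul_assoc]

/-- The unit of the convolution algebra. -/
def dirac [DecidableEq G] : G → ℂ := fun x => if x = 1 then 1 else 0

theorem dirac_conv [DecidableEq G] (f : G → ℂ) : conv dirac f = f := by
  funext x
  simp [conv, dirac]

theorem conv_dirac [DecidableEq G] (f : G → ℂ) : conv f dirac = f := by
  funext x
  simp [conv, dirac, inv_mul_eq_one]

theorem conv_add (f g h : G → ℂ) : conv f (g + h) = conv f g + conv f h := by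
  funext x
  simp [conv, mul_add, Finset.sum_add_distrib]

theorem add_conv (f g h : G → ℂ) : conv (f + g) h = conv f h + conv g h := by
  funext x
  simp [conv, add_mul, Finset.sum_add_distrib]

theorem conv_smul (c : ℂ) (f g : G → ℂ) : conv f (c • g) = c • conv f g := by
  funext x
  simp only [conv, Pi.smul_apply, smul_eq_mul, Finset.mul_sum]
  exact Finset.sum_congr rfl fun t _ => by ring

theorem smul_conv (c : ℂ) (f g : G → ℂ) : conv (c • f) g = c • conv f g := by
  funext x
  simp only [conv, Pi.smul_apply, smul_eq_mul, Finset.mul_sum]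
  exact Finset.sum_congr rfl fun t _ => by ring

theorem conv_zero (f : G → ℂ) : conv f 0 = 0 := by
  funext x
  simp [conv]

theorem zero_conv (f : G → ℂ) : conv 0 f = 0 := by
  funext x
  simp [conv]

theorem adj_conv (f g : G → ℂ) : adj (conv f g) = conv (adj g) (adj f) := by
  funext x
  simp only [adj, conv, map_sum, map_mul]
  refine Fintype.sum_equiv (Equiv.mulLeft x) _ _ fun t => ?_
  simp [mul_comm]

theorem eq_zero_of_adj_conv_self {f : G → ℂ} (h : conv (adj f) f = 0) : f = 0 := by
  have h1 : ∑ t : G, (Complex.normSq (f t⁻¹) : ℝ) = 0 := by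
    have h2 := congrFun h 1
    simp only [conv, adj, mul_one, Pi.zero_apply] at h2
    have h3 : ((∑ t : G, (Complex.normSq (f t⁻¹) : ℝ) : ℝ) : ℂ) = 0 := by
      rw [← h2]
      push_cast
      exact Finset.sum_congr rfl fun t _ => Complex.normSq_eq_conj_mul_self
    exact_mod_cast h3
  funext x
  have h4 := (Finset.sum_eq_zero_iff_of_nonneg
    (fun t _ => Complex.normSq_nonneg (f t⁻¹))).1 h1 x⁻¹ (Finset.mem_univ _)
  simpa using h4

theorem IsCentral.adj {f : G → ℂ} (hf : IsCentral f) : IsCentral (adj f) := by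
  intro g
  have h := congrArg UnitaryWeingarten.adj (hf (UnitaryWeingarten.adj g))
  rw [adj_conv, adj_conv, adj_adj] at h
  exact h.symm

theorem IsCentral.conv {f g : G → ℂ} (hf : IsCentral f) (hg : IsCentral g) :
    IsCentral (conv f g) := by
  intro h
  rw [conv_assoc, hg h, ← conv_assoc, hf h, conv_assoc]

theorem IsCentral.conv_eq_zero {a x : G → ℂ} (ha : IsCentral a)
    (h : UnitaryWeingarten.conv a (UnitaryWeingarten.conv a x) = 0) :
    UnitaryWeingarten.conv a x = 0 := by
  set y := UnitaryWeingarten.conv a x with hy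
  have hw : UnitaryWeingarten.conv (UnitaryWeingarten.adj a) y = 0 := by
    apply eq_zero_of_adj_conv_self
    rw [adj_conv, adj_adj, conv_assoc, ← conv_assoc a, ha (UnitaryWeingarten.adj a),
      conv_assoc (UnitaryWeingarten.adj a), h, conv_zero, conv_zero]
  apply eq_zero_of_adj_conv_self
  have h1 : UnitaryWeingarten.adj y
      = UnitaryWeingarten.conv (UnitaryWeingarten.adj x) (UnitaryWeingarten.adj a) := by
    rw [hy, adj_conv]
  rw [h1, conv_assoc, hw, conv_zero]

/-- The centre of the convolution algebra as a subspace. -/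
def centre (G : Type*) [Group G] [Fintype G] : Submodule ℂ (G → ℂ) where
  carrier := {f | IsCentral f}
  add_mem' := by
    intro f g hf hg h
    rw [add_conv, conv_add, hf h, hg h]
  zero_mem' := by
    intro h
    rw [zero_conv, conv_zero]
  smul_mem' := by
    intro c f hf h
    rw [smul_conv, conv_smul, hf h]

theorem exists_isCentralPseudoInverse {a : G → ℂ} (ha : IsCentral a) :
    ∃ b, IsCentralPseudoInverse a b := by
  classical
  let L : centre G →ₗ[ℂ] centre G :=
    { toFun := fun x => ⟨conv a x.1, ha.conv x.2⟩
      map_add' := fun x y => Subtype.ext (conv_add a x.1 y.1)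
      map_smul' := fun c x => Subtype.ext (conv_smul c a x.1) }
  have hker : LinearMap.ker (L ∘ₗ L) = LinearMap.ker L := by
    ext x
    simp only [LinearMap.mem_ker, LinearMap.comp_apply]
    constructor
    · intro h
      exact Subtype.ext (ha.conv_eq_zero (congrArg Subtype.val h))
    · intro h
      rw [h, map_zero]
  have hrange : LinearMap.range (L ∘ₗ L) = LinearMap.range L := by
    apply Submodule.eq_of_le_of_finrank_eq (LinearMap.range_comp_le_range L L)
    have h1 := LinearMap.finrank_range_add_finrank_ker (L ∘ₗ L)
    have h2 := LinearMap.finrank_range_add_finrank_ker L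
    rw [hker] at h1
    omega
  have hdirac : IsCentral (dirac : G → ℂ) := fun g => by rw [dirac_conv, conv_dirac]
  have hmem : L ⟨dirac, hdirac⟩ ∈ LinearMap.range (L ∘ₗ L) := by
    rw [hrange]
    exact LinearMap.mem_range_self L _
  obtain ⟨⟨c, hc⟩, hc2⟩ := hmem
  have hc' : IsCentral c := hc
  have key : conv a (conv a c) = a := by
    have h := congrArg Subtype.val hc2
    change conv a (conv a c) = conv a dirac at h
    rw [h, conv_dirac]
  have key2 : conv c (conv a a) = a := by
    rw [hc', conv_assoc, key]
  have hcb : conv a (conv c (conv c a)) = conv c a := by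
    rw [← conv_assoc c c a, ha (conv (conv c c) a), conv_assoc, conv_assoc, key2]
  refine ⟨conv c (conv c a), hc'.conv (hc'.conv ha), ?_, ?_⟩
  · rw [hcb, conv_assoc, key2]
  · have h1 : conv (conv c (conv c a)) a = conv c a := by
      rw [conv_assoc, conv_assoc, key2]
    rw [h1, conv_assoc, hcb]

theorem IsCentralPseudoInverse.unique {a b c : G → ℂ}
    (hb : IsCentralPseudoInverse a b) (hc : IsCentralPseudoInverse a c) : b = c := by
  obtain ⟨hb0, hb1, hb2⟩ := hb
  obtain ⟨hc0, hc1, hc2⟩ := hc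
  have h : conv a b = conv a c := by
    calc conv a b = conv (conv (conv a c) a) b := by rw [hc1]
      _ = conv a c := by
        rw [conv_assoc, ← hb0 a, conv_assoc a, hc0 (conv b a), conv_assoc b, ← conv_assoc a b,
          ← conv_assoc, hb1]
  calc b = conv (conv b a) b := hb2.symm
    _ = conv (conv a b) b := by rw [hb0 a]
    _ = conv (conv a c) b := by rw [h]
    _ = conv c (conv a b) := by rw [← hc0 a, conv_assoc]
    _ = conv c (conv a c) := by rw [h]
    _ = c := by rw [← conv_assoc, hc2]

end Convolution

/-! ## Cycle statistics and the unitary Weingarten function -/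

variable {k : ℕ}

/-- The number `κ(π)` of cycles of `π ∈ S_k`, fixed points included. -/
def kappa (π : Equiv.Perm (Fin k)) : ℕ := π.partition.parts.card

/-- The function `z^{κ(·)}` on `S_k`. -/
def powKappa (k : ℕ) (z : ℂ) : Equiv.Perm (Fin k) → ℂ := fun π => z ^ kappa π

theorem kappa_conj (π τ : Equiv.Perm (Fin k)) : kappa (τ * π * τ⁻¹) = kappa π := by
  unfold kappa
  rw [Equiv.Perm.partition_eq_of_isConj.1 (isConj_iff.2 ⟨τ, rfl⟩ : IsConj π (τ * π * τ⁻¹))]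

theorem isCentral_powKappa (k : ℕ) (z : ℂ) : IsCentral (powKappa k z) := by
  intro g
  funext x
  simp only [conv]
  refine Fintype.sum_equiv ((Equiv.inv _).trans (Equiv.mulRight x)) _ _ fun t => ?_
  have h : kappa ((t⁻¹ * x)⁻¹ * x) = kappa t := by
    have h1 := kappa_conj t x⁻¹
    simpa [mul_assoc] using h1
  simp only [Equiv.trans_apply, Equiv.inv_apply, Equiv.coe_mulRight, powKappa, h]
  ring

/-- There is exactly one pseudo-inverse of `z^{κ(·)}` in the centre. -/
theorem existsUnique_wg (k : ℕ) (z : ℂ) :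
    ∃! w : Equiv.Perm (Fin k) → ℂ, IsCentralPseudoInverse (powKappa k z) w := by
  obtain ⟨w, hw⟩ := exists_isCentralPseudoInverse (isCentral_powKappa k z)
  exact ⟨w, hw, fun v hv => hv.unique hw⟩

/-- The unitary Weingarten function `Wg^U(·; z)` on `S_k`: the unique pseudo-inverse of
`z^{κ(·)}` in the centre of the convolution algebra of `S_k`. -/
def wg (k : ℕ) (z : ℂ) : Equiv.Perm (Fin k) → ℂ := (existsUnique_wg k z).choose

theorem wg_spec (k : ℕ) (z : ℂ) : IsCentralPseudoInverse (powKappa k z) (wg k z) :=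
  (existsUnique_wg k z).choose_spec.1

/-- The double unitary Weingarten function `Wg^U(·; z, w) = Wg^U(·; z) * Wg^U(·; w)`. -/
def doubleWg (k : ℕ) (z w : ℂ) : Equiv.Perm (Fin k) → ℂ := conv (wg k z) (wg k w)

/-- `δ_π(i, i') = ∏ₛ δ_{i_{π(s)}, i'_s}`. -/
def delta {ι : Type*} [DecidableEq ι] (π : Equiv.Perm (Fin k)) (i i' : Fin k → ι) : ℂ :=
  ∏ s : Fin k, if i (π s) = i' s then 1 else 0

/-- `Tr_π(A) = ∏ⱼ Tr(A^{μⱼ})`, where `μ` is the cycle-type of `π` (fixed points included). -/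
def trPerm {n : ℕ} (π : Equiv.Perm (Fin k)) (A : Matrix (Fin n) (Fin n) ℂ) : ℂ :=
  (π.partition.parts.map fun m => (A ^ m).trace).prod

/-- The entrywise (equivalently, Borel) sigma-algebra on complex `n × p` matrices. -/
instance matrixMeasurableSpace (n p : ℕ) : MeasurableSpace (Matrix (Fin n) (Fin p) ℂ) :=
  inferInstanceAs (MeasurableSpace (Fin n → Fin p → ℂ))

end UnitaryWeingarten

end

open UnitaryWeingarten MeasureTheory ProbabilityTheory
open scoped ComplexConjugate

/-! Fix the column indices and regard the moments as a matrix `A` in the row multi-indices. Left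
invariance of `X` says that `A` commutes with `U^{⊗k}` for every unitary `U`. By Schur–Weyl duality
such an `A` is a combination of the permutation operators `delta σ`, and the Weingarten function
expresses its coefficients through the twisted traces `∑ c, A c (c ∘ τ)`: this is `eq_sum_wg_delta`.
Right invariance gives the same expansion in the column indices after transposing `X`. Combining the
two leaves only moments traced over both rows and columns, which are `E[Tr_π(XX*)]` by
`sum_entryProd_perm`. A change of variables then turns the two Weingarten factors into their
convolution (`sum_wg_mul_wg`).

No Haar integral is used. Commutation with `U^{⊗k}` extends from unitary `U` to all matrices
(`commute_tensorPow`), then to every kernel invariant under simultaneous permutation of its two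
multi-indices (`commute_of_perm_invariant`). It is applied to kernels built from `wg` whose sum
reproduces the identity. That reproducing property, `sum_wg_delta_one`, needs only a pseudo-inverse,
so it also covers `n < k`: the kernel of the Gram matrix `n^κ(σ⁻¹τ)` consists exactly of the linear
relations among permutation operators. -/

/-- Two functions on a finite type whose fibres have equal cardinalities differ by a permutation. -/
theorem exists_perm_comp_eq_of_card_fiber_eq {α β : Type*} [Fintype α] [DecidableEq β]
    {f g : α → β} (h : ∀ b, Fintype.card {a // f a = b} = Fintype.card {a // g a = b}) :
    ∃ σ : Equiv.Perm α, g ∘ σ = f :=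
  ⟨Equiv.ofFiberEquiv fun b => Fintype.equivOfCardEq (h b),
    funext fun a => Equiv.ofFiberEquiv_map _ a⟩

/-! ### Matrices commuting with all tensor powers of unitaries. -/

section TensorPower

variable {ι : Type*} {k : ℕ}

/-- The matrix of `Y ⊗ ⋯ ⊗ Y` (`k` factors). -/
def tensorPow (k : ℕ) (Y : Matrix ι ι ℂ) : Matrix (Fin k → ι) (Fin k → ι) ℂ :=
  fun a b => ∏ s, Y (a s) (b s)

theorem tensorPow_mul [Fintype ι] (Y Z : Matrix ι ι ℂ) :
    tensorPow k (Y * Z) = tensorPow k Y * tensorPow k Z := by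
  ext a b
  simp only [tensorPow, Matrix.mul_apply, Fintype.prod_sum, Finset.prod_mul_distrib]

theorem tensorPow_diagonal [DecidableEq ι] (d : ι → ℂ) :
    tensorPow k (Matrix.diagonal d) = Matrix.diagonal fun a => ∏ s, d (a s) := by
  ext a b
  by_cases h : a = b
  · subst h
    simp [tensorPow]
  · obtain ⟨s, hs⟩ := Function.ne_iff.1 h
    rw [Matrix.diagonal_apply_ne _ h]
    exact Finset.prod_eq_zero (Finset.mem_univ s) (Matrix.diagonal_apply_ne _ hs)

theorem tensorPow_one [DecidableEq ι]
    : tensorPow k (1 : Matrix ι ι ℂ) = 1 := by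
  rw [← Matrix.diagonal_one, tensorPow_diagonal]
  simp

theorem prod_ite_eq_pow_card_fiber [DecidableEq ι] (c : Fin k → ι) (x : ι) (z : ℂ) :
    ∏ s, (if c s = x then z else 1) = z ^ Fintype.card {s // c s = x} := by
  rw [Finset.prod_ite, Finset.prod_const, Finset.prod_const_one, mul_one, Fintype.card_subtype]

/-- Diagonal unitaries force `A a b = 0` unless `a` and `b` take each value equally often, that is,
unless they are rearrangements of each other. On such pairs any diagonal tensor power has equal
eigenvalues. -/
theorem commute_tensorPow_diagonal [Fintype ι] [DecidableEq ι]
    {A : Matrix (Fin k → ι) (Fin k → ι) ℂ}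
    (hA : ∀ U ∈ Matrix.unitaryGroup ι ℂ, Commute A (tensorPow k U)) (d : ι → ℂ) :
    Commute A (tensorPow k (Matrix.diagonal d)) := by
  rw [tensorPow_diagonal]
  ext a b
  rw [Matrix.mul_diagonal, Matrix.diagonal_mul]
  by_cases h0 : A a b = 0
  · simp [h0]
  have hcard : ∀ x, Fintype.card {s // a s = x} = Fintype.card {s // b s = x} := by
    intro x
    -- Fibre sizes lie in `{0, …, k}`, so powers of a primitive `(k + 1)`-th root of unity tell them
    -- apart.
    set z : ℂ := Complex.exp (2 * Real.pi * Complex.I / (k + 1 : ℕ)) with hz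
    have hprim : IsPrimitiveRoot z (k + 1) := Complex.isPrimitiveRoot_exp (k + 1) (by omega)
    have hnorm : ‖z‖ = 1 := hprim.norm'_eq_one (by omega)
    have hzz : z * conj z = 1 := by
      rw [Complex.mul_conj, Complex.normSq_eq_norm_sq, hnorm]; simp
    have hU : Matrix.diagonal (fun y => if y = x then z else 1) ∈ Matrix.unitaryGroup ι ℂ := by
      rw [Matrix.mem_unitaryGroup_iff, Matrix.star_eq_conjTranspose,
        Matrix.diagonal_conjTranspose, Matrix.diagonal_mul_diagonal, ← Matrix.diagonal_one]
      congr 1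
      funext y
      by_cases hy : y = x
      · simpa [hy] using hzz
      · simp [hy]
    have h1 := congrFun (congrFun (hA _ hU) a) b
    rw [tensorPow_diagonal, Matrix.mul_diagonal, Matrix.diagonal_mul, mul_comm] at h1
    have h2 := mul_right_cancel₀ h0 h1
    rw [prod_ite_eq_pow_card_fiber, prod_ite_eq_pow_card_fiber] at h2
    have hlt : ∀ c : Fin k → ι, Fintype.card {s // c s = x} < k + 1 := fun c =>
      Nat.lt_succ_of_le ((Fintype.card_subtype_le _).trans (by simp))
    exact (hprim.pow_inj (hlt b) (hlt a) h2).symm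
  obtain ⟨σ, hσ⟩ := exists_perm_comp_eq_of_card_fiber_eq hcard
  have h3 : ∏ s, d (a s) = ∏ s, d (b s) := by
    rw [← hσ]
    exact Equiv.prod_comp σ fun s => d (b s)
  rw [h3, mul_comm]

theorem exists_unitary_diagonal_of_isHermitian [Fintype ι] [DecidableEq ι] {H : Matrix ι ι ℂ}
    (hH : H.IsHermitian) :
    ∃ U ∈ Matrix.unitaryGroup ι ℂ, ∃ d : ι → ℂ, H = U * Matrix.diagonal d * star U :=
  ⟨hH.eigenvectorUnitary, hH.eigenvectorUnitary.2, _, by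
    conv_lhs => rw [hH.spectral_theorem, Unitary.conjStarAlgAut_apply]⟩

theorem commute_tensorPow_of_isHermitian [Fintype ι] [DecidableEq ι]
    {A : Matrix (Fin k → ι) (Fin k → ι) ℂ}
    (hA : ∀ U ∈ Matrix.unitaryGroup ι ℂ, Commute A (tensorPow k U)) {H : Matrix ι ι ℂ}
    (hH : H.IsHermitian) : Commute A (tensorPow k H) := by
  obtain ⟨U, hU, d, rfl⟩ := exists_unitary_diagonal_of_isHermitian hH
  rw [tensorPow_mul, tensorPow_mul]
  exact ((hA U hU).mul_right (commute_tensorPow_diagonal hA d)).mul_right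
    (hA _ (Unitary.star_mem hU))

/-- Write `Y = H₁ + i H₂` with both parts Hermitian. Each entry of the commutator with `(H₁ + t
H₂)^{⊗k}` is a polynomial in `t` that vanishes for real `t`, hence also at `t = i`. -/
theorem commute_tensorPow [Fintype ι] [DecidableEq ι]
    {A : Matrix (Fin k → ι) (Fin k → ι) ℂ}
    (hA : ∀ U ∈ Matrix.unitaryGroup ι ℂ, Commute A (tensorPow k U)) (Y : Matrix ι ι ℂ) :
    Commute A (tensorPow k Y) := by
  set H₁ : Matrix ι ι ℂ := (1 / 2 : ℂ) • (Y + Y.conjTranspose) with hH₁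
  set H₂ : Matrix ι ι ℂ := (-Complex.I / 2 : ℂ) • (Y - Y.conjTranspose) with hH₂
  have hY : Y = H₁ + Complex.I • H₂ := by
    ext a b
    simp only [hH₁, hH₂, Matrix.add_apply, Matrix.smul_apply, Matrix.sub_apply, smul_eq_mul]
    linear_combination (Y a b - Y.conjTranspose a b) / 2 * Complex.I_mul_I
  have hherm : ∀ t : ℝ, (H₁ + (t : ℂ) • H₂).IsHermitian := by
    intro t
    ext a b
    simp only [hH₁, hH₂, Matrix.conjTranspose_apply, Matrix.add_apply, Matrix.smul_apply,
      Matrix.sub_apply, smul_eq_mul, star_add, star_mul', star_sub, RCLike.star_def,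
      map_div₀, map_neg, Complex.conj_I, Complex.conj_ofReal, Complex.conj_conj, map_one, map_ofNat]
    ring
  ext a b
  let q : (Fin k → ι) → (Fin k → ι) → Polynomial ℂ := fun c e =>
    ∏ s, (Polynomial.C (H₁ (c s) (e s)) + Polynomial.X * Polynomial.C (H₂ (c s) (e s)))
  let r : Polynomial ℂ := ∑ c, Polynomial.C (A a c) * q c b - ∑ c, q a c * Polynomial.C (A c b)
  have hr : ∀ t : ℂ, r.eval t = (A * tensorPow k (H₁ + t • H₂)) a b
      - (tensorPow k (H₁ + t • H₂) * A) a b := by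
    intro t
    simp [r, q, Matrix.mul_apply, tensorPow, Polynomial.eval_finsetSum, Polynomial.eval_prod,
      mul_comm t]
  have hr0 : r = 0 := by
    apply Polynomial.eq_zero_of_infinite_isRoot
    refine (Set.infinite_range_of_injective Complex.ofReal_injective).mono ?_
    rintro _ ⟨t, rfl⟩
    rw [Set.mem_ofPred_eq, Polynomial.IsRoot, hr,
      (commute_tensorPow_of_isHermitian hA (hherm t)).eq, sub_self]
  have h := hr Complex.I
  rw [hr0, Polynomial.eval_zero, ← hY] at h
  exact (sub_eq_zero.1 h.symm)

theorem exists_perm_of_sum_single_eq {f g : Fin k → ι}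
    (h : ∑ s, Finsupp.single (f s) 1 = ∑ s, Finsupp.single (g s) (1 : ℕ)) :
    ∃ σ : Equiv.Perm (Fin k), g ∘ σ = f := by
  classical
  apply exists_perm_comp_eq_of_card_fiber_eq
  intro b
  have h1 := DFunLike.congr_fun h b
  simpa [Finsupp.finsetSum_apply, Finsupp.single_apply, Fintype.card_subtype] using h1

/-- Commutation with every `Y^{⊗k}` is a polynomial identity in the entries of `Y`. A linear
functional replacing the monomial `∏ s, Y (c s) (e s)` by `T c e` turns it into commutation with
`T`. It is well defined because a monomial determines `(c, e)` up to a simultaneous permutation. -/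
theorem commute_of_perm_invariant [Fintype ι] [DecidableEq ι]
    {A : Matrix (Fin k → ι) (Fin k → ι) ℂ}
    (hA : ∀ U ∈ Matrix.unitaryGroup ι ℂ, Commute A (tensorPow k U))
    {T : Matrix (Fin k → ι) (Fin k → ι) ℂ}
    (hT : ∀ (ρ : Equiv.Perm (Fin k)) (a b), T (a ∘ ρ) (b ∘ ρ) = T a b) : Commute A T := by
  classical
  ext a b
  let m : (Fin k → ι × ι) → (ι × ι →₀ ℕ) := fun e => ∑ s, Finsupp.single (e s) 1
  -- The value `0` is given to exponents of total degree other than `k`, which never occur below.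
  let v : (ι × ι →₀ ℕ) → ℂ := fun x =>
    if h : ∃ e, m e = x then T (fun s => (h.choose s).1) (fun s => (h.choose s).2) else 0
  have hv : ∀ c e : Fin k → ι, v (m fun s => (c s, e s)) = T c e := by
    intro c e
    have h : ∃ e', m e' = m fun s => (c s, e s) := ⟨_, rfl⟩
    obtain ⟨σ, hσ⟩ := exists_perm_of_sum_single_eq h.choose_spec
    simp only [v, dif_pos h]
    rw [← hT σ c e, ← hσ]
    rfl
  let L : MvPolynomial (ι × ι) ℂ →ₗ[ℂ] ℂ := (MvPolynomial.basisMonomials (ι × ι) ℂ).constr ℂ v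
  have hL : ∀ c e : Fin k → ι, L (∏ s, MvPolynomial.X (c s, e s)) = T c e := by
    intro c e
    have h1 : (∏ s, MvPolynomial.X (c s, e s) : MvPolynomial (ι × ι) ℂ)
        = MvPolynomial.basisMonomials (ι × ι) ℂ (m fun s => (c s, e s)) := by
      rw [MvPolynomial.coe_basisMonomials]
      dsimp only [m]
      rw [MvPolynomial.monomial_sum_one]
      rfl
    rw [h1, Module.Basis.constr_basis, hv]
  let r : MvPolynomial (ι × ι) ℂ :=
    ∑ c, A a c • ∏ s, MvPolynomial.X (c s, b s) - ∑ c, A c b • ∏ s, MvPolynomial.X (a s, c s)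
  have hr0 : r = 0 := by
    apply MvPolynomial.funext
    intro x
    have h1 := congrFun (congrFun (commute_tensorPow hA fun i j => x (i, j)) a) b
    simp only [Matrix.mul_apply, tensorPow] at h1
    simp only [r, map_sub, map_sum, map_zero, MvPolynomial.smul_eval, map_prod,
      MvPolynomial.eval_X]
    rw [h1, sub_eq_zero]
    exact Finset.sum_congr rfl fun c _ => mul_comm _ _
  have h2 := congrArg L hr0
  simp only [r, map_sub, map_sum, map_smul, hL, map_zero, smul_eq_mul] at h2
  rw [Matrix.mul_apply, Matrix.mul_apply, sub_eq_zero.1 h2]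
  exact Finset.sum_congr rfl fun c _ => mul_comm _ _

end TensorPower

/-! ### Traces of tensor powers twisted by a permutation. -/

section CycleSum

open Equiv

/-- The product over the parts of the partition of a permutation, as a product over its orbits. -/
theorem prod_orbits_eq_prod_partition {α M : Type*} [Fintype α] [DecidableEq α] [CommMonoid M]
    (ρ : Perm α) [Fintype (Quotient (Perm.SameCycle.setoid ρ))]
    [DecidableEq (Quotient (Perm.SameCycle.setoid ρ))] (f : ℕ → M) :
    ∏ q : Quotient (Perm.SameCycle.setoid ρ), f (Fintype.card {s : α // ⟦s⟧ = q}) =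
      (ρ.partition.parts.map f).prod := by
  classical
  let Q := Quotient (Perm.SameCycle.setoid ρ)
  -- An orbit goes to the cycle carried by it. Nontrivial orbits thus match the cycle factors, and
  -- those with `w q = 1` are the fixed points, giving the parts equal to `1`.
  let w : Q → Perm α := Quotient.lift (fun x => ρ.cycleOf x) fun _ _ h => Perm.SameCycle.cycleOf_eq h
  have hw : ∀ x : α, w ⟦x⟧ = 1 ↔ ρ x = x := fun x => Perm.cycleOf_eq_one_iff ρ
  rw [Perm.parts_partition, Multiset.map_add, Multiset.prod_add, Multiset.map_replicate,
    Multiset.prod_replicate, Perm.cycleType_def, Multiset.map_map,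
    ← Finset.prod_filter_mul_prod_filter_not Finset.univ (fun q => w q ≠ 1)]
  congr 1
  · refine Finset.prod_nbij w ?_ ?_ ?_ ?_
    · intro q hq
      induction q using Quotient.inductionOn with | _ x
      rw [Finset.mem_filter] at hq
      exact Perm.cycleOf_mem_cycleFactorsFinset_iff.2
        (Perm.mem_support.2 fun h => hq.2 ((hw x).2 h))
    · intro q hq r hr h
      induction q using Quotient.inductionOn with | _ x
      induction r using Quotient.inductionOn with | _ y
      simp only [Finset.coe_filter, Finset.mem_univ, true_and] at hq hr
      exact Quotient.sound ((Perm.sameCycle_iff_cycleOf_eq_of_mem_support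
        (Perm.mem_support.2 fun h => hq ((hw x).2 h))
        (Perm.mem_support.2 fun h => hr ((hw y).2 h))).2 h)
    · intro c hc
      have hc' : c ∈ ρ.cycleFactorsFinset := hc
      obtain ⟨x, hx⟩ := (Perm.mem_cycleFactorsFinset_iff.1 hc').1.nonempty_support
      have hcx := Perm.cycle_is_cycleOf hx hc'
      have hxs := Perm.mem_cycleFactorsFinset_support_le hc' hx
      refine ⟨⟦x⟧, ?_, hcx.symm⟩
      simpa [hw] using hxs
    · intro q hq
      induction q using Quotient.inductionOn with | _ x
      rw [Finset.mem_filter] at hq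
      have hx : ρ x ≠ x := fun h => hq.2 ((hw x).2 h)
      rw [Function.comp_apply, Function.comp_apply, Fintype.card_subtype]
      congr 2
      ext y
      change _ ↔ y ∈ (ρ.cycleOf x).support
      rw [Perm.mem_support_cycleOf_iff' hx, Finset.mem_filter, Quotient.eq]
      exact ⟨fun h => h.2.symm, fun h => ⟨Finset.mem_univ _, h.symm⟩⟩
  · have hcard : (Finset.univ.filter fun q : Q => ¬ w q ≠ 1).card
        = Fintype.card α - ρ.support.card := by
      rw [← Finset.card_compl]
      symm
      refine Finset.card_nbij (fun x => (⟦x⟧ : Q)) ?_ ?_ ?_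
      · intro x hx
        simpa [hw] using hx
      · intro x hx y hy h
        have hx' : ρ x = x := by simpa using hx
        exact ((Perm.SameCycle.eq_of_left (Quotient.exact h) hx'))
      · intro q hq
        induction q using Quotient.inductionOn with | _ x
        refine ⟨x, ?_, rfl⟩
        simpa [hw] using hq
    rw [← hcard, ← Finset.prod_const]
    refine Finset.prod_congr rfl fun q hq => ?_
    induction q using Quotient.inductionOn with | _ x
    have hx : ρ x = x := by simpa [hw] using hq
    congr 1
    rw [Fintype.card_eq_one_iff]
    refine ⟨⟨x, rfl⟩, fun y => Subtype.ext ?_⟩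
    exact (Perm.SameCycle.eq_of_left (Perm.SameCycle.symm (Quotient.exact y.2)) hx).symm

theorem apply_eq_of_sameCycle {α β : Type*} [Finite α] {ρ : Perm α} {c : α → β}
    (hc : ∀ s, c s = c (ρ s)) {x y : α} (h : ρ.SameCycle x y) : c x = c y := by
  obtain ⟨m, -, -, rfl⟩ := h.exists_pow_eq''
  clear h
  induction m with
  | zero => rfl
  | succ m ih => rw [pow_succ', Perm.mul_apply, ← hc, ih]

variable {ι : Type*} {k : ℕ}

/-- Only multi-indices constant on the cycles of `ρ` contribute, and these are functions on the set
of orbits. -/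
theorem sum_tensorPow_diagonal_perm [Fintype ι] [DecidableEq ι] (ρ : Perm (Fin k)) (d : ι → ℂ) :
    ∑ c, tensorPow k (Matrix.diagonal d) c (c ∘ ρ) =
      (ρ.partition.parts.map fun m => ∑ x, d x ^ m).prod := by
  classical
  let Q := Quotient (Perm.SameCycle.setoid ρ)
  let e : (Q → ι) → Fin k → ι := fun c s => c ⟦s⟧
  have he : Function.Injective e := fun c c' h =>
    funext fun q => q.inductionOn fun s => congrFun h s
  rw [← prod_orbits_eq_prod_partition, Fintype.prod_sum]
  symm
  refine Fintype.sum_of_injective e he _ _ ?_ ?_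
  · intro c hc
    by_contra hne
    refine hc ⟨Quotient.lift c fun x y h => apply_eq_of_sameCycle (ρ := ρ) ?_ h, rfl⟩
    intro s
    by_contra hs
    exact hne (Finset.prod_eq_zero (Finset.mem_univ s) (Matrix.diagonal_apply_ne _ hs))
  · intro c
    have h1 : tensorPow k (Matrix.diagonal d) (e c) (e c ∘ ρ) = ∏ s, d (e c s) := by
      refine Finset.prod_congr rfl fun s _ => ?_
      have h2 : (e c ∘ ρ) s = e c s := congrArg c (Quotient.sound ⟨-1, by simp⟩)
      rw [h2, Matrix.diagonal_apply_eq]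
    rw [h1, ← Finset.prod_fiberwise Finset.univ (fun s : Fin k => (⟦s⟧ : Q))]
    refine Finset.prod_congr rfl fun q _ => ?_
    rw [Fintype.card_subtype, ← Finset.prod_const]
    refine Finset.prod_congr rfl fun s hs => ?_
    rw [← (Finset.mem_filter.1 hs).2]

theorem sum_comp_perm [Fintype ι] (ρ : Perm (Fin k)) (F : (Fin k → ι) → ℂ) :
    ∑ c, F (c ∘ ρ) = ∑ c, F c :=
  Equiv.sum_comp (ρ.symm.arrowCongr (Equiv.refl ι)) F

theorem tensorPow_comp_perm (Y : Matrix ι ι ℂ) (ρ : Perm (Fin k)) (a b : Fin k → ι) :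
    tensorPow k Y (a ∘ ρ) (b ∘ ρ) = tensorPow k Y a b :=
  Equiv.prod_comp ρ fun s => Y (a s) (b s)

/-- Cyclicity of the trace, twisted by the permutation operator of `ρ`, with which `N` commutes. -/
theorem sum_mul_apply_comp_perm [Fintype ι]
    (ρ : Perm (Fin k)) (M N : Matrix (Fin k → ι) (Fin k → ι) ℂ)
    (hN : ∀ a b, N (a ∘ ρ) (b ∘ ρ) = N a b) :
    ∑ c, (M * N) c (c ∘ ρ) = ∑ c, (N * M) c (c ∘ ρ) := by
  simp only [Matrix.mul_apply]
  rw [Finset.sum_comm, ← sum_comp_perm ρ]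
  refine Finset.sum_congr rfl fun a _ => Finset.sum_congr rfl fun c _ => ?_
  rw [hN, mul_comm]

/-- Diagonalisation and twisted cyclicity reduce this to the diagonal case. The Hermitian case
suffices: it is used for `Y * Y.conjTranspose` and for the identity. -/
theorem sum_tensorPow_perm_of_isHermitian {n : ℕ} (ρ : Perm (Fin k))
    {Y : Matrix (Fin n) (Fin n) ℂ} (hY : Y.IsHermitian) :
    ∑ c, tensorPow k Y c (c ∘ ρ) = trPerm ρ Y := by
  obtain ⟨U, hU, d, rfl⟩ := exists_unitary_diagonal_of_isHermitian hY
  have hUU : star U * U = 1 := Matrix.mem_unitaryGroup_iff'.1 hU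
  have hpow : ∀ m : ℕ, ((U * Matrix.diagonal d * star U) ^ m).trace = ∑ x, d x ^ m := by
    intro m
    have h : (U * Matrix.diagonal d * star U) ^ m * U = U * Matrix.diagonal d ^ m := by
      induction m with
      | zero => simp
      | succ m ih =>
        rw [pow_succ, Matrix.mul_assoc, Matrix.mul_assoc (U * _), hUU, Matrix.mul_one,
          ← Matrix.mul_assoc, ih, Matrix.mul_assoc, ← pow_succ]
    have h' : (U * Matrix.diagonal d * star U) ^ m = U * Matrix.diagonal d ^ m * star U := by
      rw [← h, Matrix.mul_assoc _ U (star U), Matrix.mem_unitaryGroup_iff.1 hU, Matrix.mul_one]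
    rw [h', Matrix.trace_mul_comm, ← Matrix.mul_assoc, hUU, Matrix.one_mul, Matrix.diagonal_pow,
      Matrix.trace_diagonal]
    rfl
  rw [tensorPow_mul, sum_mul_apply_comp_perm ρ _ _ (tensorPow_comp_perm _ ρ), tensorPow_mul,
    ← Matrix.mul_assoc, ← tensorPow_mul, hUU, tensorPow_one, Matrix.one_mul,
    sum_tensorPow_diagonal_perm, trPerm]
  simp only [hpow]

end CycleSum

/-! ### Central functions and inversion in the group. -/

section ClassFunctions

variable {G : Type*} [Group G] [Fintype G]

theorem isCentral_mul_comm {f : G → ℂ} (hf : IsCentral f) (x y : G) : f (x * y) = f (y * x) := by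
  classical
  -- Centrality tested against the point mass at `y⁻¹`.
  have h := congrFun (hf (Pi.single y⁻¹ 1)) x
  simp only [conv] at h
  rw [Finset.sum_eq_single (x * y), Finset.sum_eq_single y⁻¹] at h
  · simpa using h
  · intro t _ ht
    simp [Pi.single_eq_of_ne ht]
  · simp
  · intro t _ ht
    rw [Pi.single_eq_of_ne, mul_zero]
    intro h'
    exact ht (by rw [← inv_inv y, ← h']; group)
  · simp

theorem conv_comp_inv (f g : G → ℂ) :
    conv (fun x => f x⁻¹) (fun x => g x⁻¹) = fun x => conv g f x⁻¹ := by
  funext x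
  simp only [conv]
  refine Fintype.sum_equiv ((Equiv.inv G).trans (Equiv.mulRight x) |>.trans (Equiv.inv G)) _ _
    fun t => ?_
  simp [mul_comm]

theorem isCentralPseudoInverse_comp_inv {a b : G → ℂ} (h : IsCentralPseudoInverse a b) :
    IsCentralPseudoInverse (fun x => a x⁻¹) fun x => b x⁻¹ := by
  refine ⟨fun g => ?_, ?_, ?_⟩
  · have h1 := conv_comp_inv b fun x => g x⁻¹
    have h2 := conv_comp_inv (fun x => g x⁻¹) b
    simp only [inv_inv] at h1 h2
    rw [h1, h2, h.1]
  · rw [conv_comp_inv, conv_comp_inv, ← conv_assoc, h.2.1]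
  · rw [conv_comp_inv, conv_comp_inv, ← conv_assoc, h.2.2]

end ClassFunctions

theorem sum_comm_pairs {α β γ δ : Type*} [Fintype α] [Fintype β] [Fintype γ] [Fintype δ]
    (F : α → β → γ → δ → ℂ) :
    ∑ a, ∑ b, ∑ c, ∑ d, F a b c d = ∑ c, ∑ d, ∑ a, ∑ b, F a b c d := by
  have h := Finset.sum_comm (s := Finset.univ) (t := Finset.univ)
    (f := fun (x : α × β) (y : γ × δ) => F x.1 x.2 y.1 y.2)
  simpa only [Fintype.sum_prod_type] using h

/-! ### The Weingarten expansion of the commutant. -/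

section Weingarten

variable {k : ℕ}

theorem partition_inv (π : Equiv.Perm (Fin k)) : π⁻¹.partition = π.partition := by
  rw [Nat.Partition.ext_iff, Equiv.Perm.parts_partition, Equiv.Perm.parts_partition,
    Equiv.Perm.cycleType_inv, Equiv.Perm.support_inv]

theorem kappa_inv (π : Equiv.Perm (Fin k)) : kappa π⁻¹ = kappa π := by
  rw [kappa, kappa, partition_inv]

/-- Inversion preserves the defining properties of the pseudo-inverse, and `κ` is invariant under
it, so uniqueness applies. -/
theorem wg_inv (z : ℂ) (π : Equiv.Perm (Fin k)) : wg k z π⁻¹ = wg k z π := by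
  have h := isCentralPseudoInverse_comp_inv (wg_spec k z)
  have h1 : (fun x => powKappa k z x⁻¹) = powKappa k z := by
    funext x
    simp only [powKappa, kappa_inv]
  rw [h1] at h
  exact congrFun (h.unique (wg_spec k z)) π

theorem trPerm_conj {n : ℕ} (π τ : Equiv.Perm (Fin k)) (Y : Matrix (Fin n) (Fin n) ℂ) :
    trPerm (τ * π * τ⁻¹) Y = trPerm π Y := by
  rw [trPerm, trPerm,
    Equiv.Perm.partition_eq_of_isConj.1 (isConj_iff.2 ⟨τ, rfl⟩ : IsConj π (τ * π * τ⁻¹))]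

theorem delta_eq_ite {ι : Type*} [DecidableEq ι] (σ : Equiv.Perm (Fin k)) (a b : Fin k → ι) :
    delta σ a b = if a ∘ σ = b then 1 else 0 := by
  rw [delta, Finset.prod_ite_zero]
  simp [funext_iff]

theorem delta_comp_perm {ι : Type*} [DecidableEq ι] (σ ρ : Equiv.Perm (Fin k))
    (a b : Fin k → ι) : delta σ (a ∘ ρ) b = delta (ρ * σ) a b := rfl

theorem trPerm_one (n : ℕ) (ρ : Equiv.Perm (Fin k)) :
    trPerm ρ (1 : Matrix (Fin n) (Fin n) ℂ) = powKappa k n ρ := by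
  simp [trPerm, powKappa, kappa]

/-- The Gram matrix of the permutation operators, read off from the twisted trace of the identity
matrix. -/
theorem sum_delta_mul_delta (n : ℕ) (σ τ : Equiv.Perm (Fin k)) :
    ∑ c : Fin k → Fin n, ∑ e, delta σ c e * delta τ c e = powKappa k n (σ⁻¹ * τ) := by
  have h1 : powKappa k (n : ℂ) (σ⁻¹ * τ) = powKappa k n (τ * σ⁻¹) := by
    rw [isCentral_mul_comm (isCentral_powKappa k n)]
  rw [h1, ← trPerm_one, ← sum_tensorPow_perm_of_isHermitian _ Matrix.isHermitian_one,
    tensorPow_one]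
  refine Finset.sum_congr rfl fun c _ => ?_
  simp only [delta_eq_ite, ite_mul, one_mul, zero_mul, Finset.sum_ite_eq, Finset.mem_univ, if_true,
    Matrix.one_apply]
  congr 1
  rw [eq_iff_iff]
  constructor
  · intro h
    funext s
    simpa using (congrFun h (σ⁻¹ s)).symm
  · intro h
    funext s
    simpa using (congrFun h (σ s)).symm

/-- A vector in the kernel of the Gram matrix gives a combination `E` of permutation operators
orthogonal to each of them, hence to itself. -/
theorem sum_smul_delta_eq_zero {n : ℕ} {v : Equiv.Perm (Fin k) → ℂ}
    (hv : ∀ ρ, ∑ σ, v σ * powKappa k n (ρ⁻¹ * σ) = 0) (a b : Fin k → Fin n) :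
    ∑ σ, v σ * delta σ a b = 0 := by
  set E : (Fin k → Fin n) → (Fin k → Fin n) → ℂ := fun a b => ∑ σ, v σ * delta σ a b with hE
  have horth : ∀ ρ, ∑ a, ∑ b, delta ρ a b * E a b = 0 := by
    intro ρ
    rw [← hv ρ]
    simp only [hE, Finset.mul_sum, ← sum_delta_mul_delta]
    simp only [Finset.sum_comm (s := (Finset.univ : Finset (Equiv.Perm (Fin k))))]
    refine Finset.sum_congr rfl fun a _ => Finset.sum_congr rfl fun b _ =>
      Finset.sum_congr rfl fun σ _ => by ring
  have hconj : ∀ a b, conj (E a b) = ∑ σ, conj (v σ) * delta σ a b := by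
    intro a b
    simp only [hE, map_sum, map_mul, delta_eq_ite, apply_ite conj, map_one, map_zero]
  have hnorm : ∑ a, ∑ b, conj (E a b) * E a b = 0 := by
    have h1 : ∑ a, ∑ b, conj (E a b) * E a b
        = ∑ σ, conj (v σ) * ∑ a, ∑ b, delta σ a b * E a b := by
      simp only [hconj, Finset.sum_mul, Finset.mul_sum]
      simp only [Finset.sum_comm (t := (Finset.univ : Finset (Equiv.Perm (Fin k))))]
      refine Finset.sum_congr rfl fun σ _ => Finset.sum_congr rfl fun a _ =>
        Finset.sum_congr rfl fun b _ => by ring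
    rw [h1]
    simp only [horth, mul_zero, Finset.sum_const_zero]
  have hnorm' : ∑ a, ∑ b, Complex.normSq (E a b) = 0 := by
    simp only [← Complex.normSq_eq_conj_mul_self] at hnorm
    exact_mod_cast hnorm
  have h1 := (Finset.sum_eq_zero_iff_of_nonneg fun a _ =>
    Finset.sum_nonneg fun b _ => Complex.normSq_nonneg _).1 hnorm' a (Finset.mem_univ _)
  exact Complex.normSq_eq_zero.1 ((Finset.sum_eq_zero_iff_of_nonneg fun b _ =>
    Complex.normSq_nonneg _).1 h1 b (Finset.mem_univ _))

theorem sum_wg_delta_one (n : ℕ) (a b : Fin k → Fin n) :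
    ∑ σ, ∑ τ, delta σ a b * wg k n (σ⁻¹ * τ) * powKappa k n τ
      = (1 : Matrix (Fin k → Fin n) (Fin k → Fin n) ℂ) a b := by
  classical
  let u : Equiv.Perm (Fin k) → ℂ := fun σ => conv (wg k n) (powKappa k n) σ⁻¹
  have hu : ∀ σ, u σ = ∑ τ, wg k n (σ⁻¹ * τ) * powKappa k n τ := by
    intro σ
    refine Fintype.sum_equiv (Equiv.mulLeft σ) _ _ fun t => ?_
    simp only [Equiv.coe_mulLeft, inv_mul_cancel_left, powKappa]
    rw [← kappa_inv, mul_inv_rev, inv_inv, inv_inv]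
  -- By `n^κ * wg * n^κ = n^κ`, the function `u - δ₁` lies in the kernel of the Gram matrix. So `u`
  -- may replace the point mass `δ₁` as coefficients, although the two may differ.
  have hz : ∑ σ, (u σ - if σ = 1 then 1 else 0) * delta σ a b = 0 := by
    apply sum_smul_delta_eq_zero
    intro ρ
    have h1 : ∑ σ, u σ * powKappa k n (ρ⁻¹ * σ) = powKappa k n ρ⁻¹ := by
      conv_rhs => rw [← (wg_spec k n).2.1, conv_assoc]
      refine Fintype.sum_equiv (Equiv.mulLeft ρ⁻¹) _ _ fun σ => ?_
      simp [u, mul_comm]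
    simp only [sub_mul, Finset.sum_sub_distrib, h1]
    simp
  have h2 : delta 1 a b = (1 : Matrix (Fin k → Fin n) (Fin k → Fin n) ℂ) a b := by
    rw [delta_eq_ite, Matrix.one_apply]; rfl
  simp only [sub_mul, Finset.sum_sub_distrib, sub_eq_zero, ite_mul, one_mul, zero_mul,
    Finset.sum_ite_eq', Finset.mem_univ, if_true] at hz
  rw [← h2, ← hz]
  refine Finset.sum_congr rfl fun σ _ => ?_
  rw [hu, Finset.sum_mul]
  exact Finset.sum_congr rfl fun τ _ => by ring

/-- Schur–Weyl duality with explicit Weingarten coefficients. -/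
theorem eq_sum_wg_delta {n : ℕ} {A : Matrix (Fin k → Fin n) (Fin k → Fin n) ℂ}
    (hA : ∀ U ∈ Matrix.unitaryGroup (Fin n) ℂ, Commute A (tensorPow k U)) (a b : Fin k → Fin n) :
    A a b = ∑ σ, ∑ τ, delta σ a b * wg k n (σ⁻¹ * τ) * ∑ c, A c (c ∘ τ) := by
  -- For fixed `b` and `e` this kernel is permutation invariant, since `σ ↦ ρσ`, `τ ↦ ρτ` preserves
  -- `σ⁻¹τ`. Summing `(T b e * Y) x e` over `e` produces the Weingarten expansion of `Y`.
  let T : (Fin k → Fin n) → (Fin k → Fin n) → Matrix (Fin k → Fin n) (Fin k → Fin n) ℂ :=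
    fun b e x c => ∑ σ, ∑ τ, delta σ x b * wg k n (σ⁻¹ * τ) * delta τ c e
  have hT : ∀ b e, Commute A (T b e) := by
    intro b e
    refine commute_of_perm_invariant hA fun ρ x c => ?_
    simp only [T, delta_comp_perm]
    refine Fintype.sum_equiv (Equiv.mulLeft ρ) _ _ fun σ => ?_
    refine Fintype.sum_equiv (Equiv.mulLeft ρ) _ _ fun τ => ?_
    simp [mul_assoc]
  have hdelta : ∀ (τ : Equiv.Perm (Fin k)) (Y : Matrix (Fin k → Fin n) (Fin k → Fin n) ℂ),
      ∑ e, ∑ c, delta τ c e * Y c e = ∑ c, Y c (c ∘ τ) := by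
    intro τ Y
    rw [Finset.sum_comm]
    simp [delta_eq_ite]
  have hsum : ∀ (Y : Matrix (Fin k → Fin n) (Fin k → Fin n) ℂ) x,
      ∑ e, (T b e * Y) x e = ∑ σ, ∑ τ, delta σ x b * wg k n (σ⁻¹ * τ) * ∑ c, Y c (c ∘ τ) := by
    intro Y x
    simp only [← hdelta, Matrix.mul_apply]
    simp only [T, Finset.sum_mul, Finset.mul_sum]
    rw [sum_comm_pairs]
    refine Finset.sum_congr rfl fun σ _ => Finset.sum_congr rfl fun τ _ =>
        Finset.sum_congr rfl fun e _ => Finset.sum_congr rfl fun c _ => by ring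
  have hone : ∀ x, ∑ e, T b e x e = (1 : Matrix (Fin k → Fin n) (Fin k → Fin n) ℂ) x b := by
    intro x
    have h := hsum 1 x
    simp only [Matrix.mul_one] at h
    rw [h, ← sum_wg_delta_one]
    refine Finset.sum_congr rfl fun σ _ => Finset.sum_congr rfl fun τ _ => ?_
    rw [← trPerm_one, ← sum_tensorPow_perm_of_isHermitian _ Matrix.isHermitian_one, tensorPow_one]
  rw [← hsum A a]
  -- Once `A` stands to the left of `T b e`, the sum over `e` collapses to the identity by `hone`.
  simp only [← (hT b _).eq]
  conv_lhs => rw [← Matrix.mul_one A]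
  simp only [Matrix.mul_apply, ← hone, Finset.mul_sum]
  exact Finset.sum_comm

end Weingarten

/-! ### Mixed moments of a bi-invariant random matrix. -/

section MixedMoments

variable {n p k : ℕ}

/-- The product of the entries of `Y` at `(i, j)` and the conjugate entries at `(i', j')`. -/
def entryProd (i i' : Fin k → Fin n) (j j' : Fin k → Fin p) (Y : Matrix (Fin n) (Fin p) ℂ) : ℂ :=
  (∏ s, Y (i s) (j s)) * conj (∏ s, Y (i' s) (j' s))

theorem measurable_entry (a : Fin n) (b : Fin p) :
    Measurable fun Y : Matrix (Fin n) (Fin p) ℂ => Y a b :=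
  (measurable_pi_apply b).comp (measurable_pi_apply (X := fun _ : Fin n => Fin p → ℂ) a)

theorem measurable_entryProd (i i' : Fin k → Fin n) (j j' : Fin k → Fin p) :
    Measurable (entryProd i i' j j') :=
  (Finset.measurable_fun_prod _ fun _ _ => measurable_entry _ _).mul
    (RCLike.continuous_conj.measurable.comp
      (Finset.measurable_fun_prod _ fun _ _ => measurable_entry _ _))

theorem measurable_transpose :
    Measurable (Matrix.transpose : Matrix (Fin n) (Fin p) ℂ → Matrix (Fin p) (Fin n) ℂ) :=
  measurable_pi_lambda _ fun b => measurable_pi_lambda _ fun a => measurable_entry a b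

theorem entryProd_mul (U : Matrix (Fin n) (Fin n) ℂ) (Y : Matrix (Fin n) (Fin p) ℂ)
    (i i' : Fin k → Fin n) (j j' : Fin k → Fin p) :
    entryProd i i' j j' (U * Y) =
      ∑ a, ∑ b, tensorPow k U i a * conj (tensorPow k U i' b) * entryProd a b j j' Y := by
  simp only [entryProd, tensorPow, Matrix.mul_apply, Fintype.prod_sum, Finset.prod_mul_distrib,
    map_sum, map_mul, Finset.sum_mul_sum]
  exact Finset.sum_congr rfl fun a _ => Finset.sum_congr rfl fun b _ => by ring

/-- Summing over `e` pairs each entry with a conjugate one and leaves the trace of `(Y Y*)^{⊗k}`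
twisted by `στ⁻¹`, a conjugate of `τ⁻¹σ`. -/
theorem sum_entryProd_perm (Y : Matrix (Fin n) (Fin p) ℂ) (σ τ : Equiv.Perm (Fin k)) :
    ∑ c, ∑ e, entryProd c (c ∘ σ) e (e ∘ τ) Y = trPerm (τ⁻¹ * σ) (Y * Y.conjTranspose) := by
  have h1 : trPerm (τ⁻¹ * σ) (Y * Y.conjTranspose) = trPerm (σ * τ⁻¹) (Y * Y.conjTranspose) := by
    rw [← trPerm_conj _ τ]
    simp
  rw [h1, ← sum_tensorPow_perm_of_isHermitian _ (Matrix.isHermitian_mul_conjTranspose_self Y)]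
  refine Finset.sum_congr rfl fun c _ => ?_
  simp only [tensorPow, Matrix.mul_apply, Fintype.prod_sum, Finset.prod_mul_distrib, entryProd,
    map_prod, Matrix.conjTranspose_apply, RCLike.star_def]
  refine Finset.sum_congr rfl fun e _ => congrArg _ ?_
  refine Fintype.prod_equiv τ _ _ fun s => ?_
  simp

variable {Ω : Type*} [MeasurableSpace Ω] {P : Measure Ω}

/-- The mixed moments of `X` with fixed column indices, as a matrix in the row indices. -/
noncomputable def momentMatrix (P : Measure Ω) (X : Ω → Matrix (Fin n) (Fin p) ℂ) (j j' : Fin k → Fin p) :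
    Matrix (Fin k → Fin n) (Fin k → Fin n) ℂ :=
  fun i i' => ∫ ω, entryProd i i' j j' (X ω) ∂P

/-- Hölder: a product of `k` functions in `L^{2k}` lies in `L²`, and a product of two functions in
`L²` is integrable. -/
theorem integrable_entryProd (hk : 0 < k) {X : Ω → Matrix (Fin n) (Fin p) ℂ}
    (hmom : ∀ a b, MemLp (fun ω => X ω a b) ((2 * k : ℕ) : ENNReal) P)
    (i i' : Fin k → Fin n) (j j' : Fin k → Fin p) :
    Integrable (fun ω => entryProd i i' j j' (X ω)) P := by
  have hexp : (∑ _s : Fin k, (((2 * k : ℕ) : ENNReal))⁻¹)⁻¹ = 2 := by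
    have hk0 : (k : ENNReal) ≠ 0 := by exact_mod_cast hk.ne'
    have h : (k : ENNReal) * (2 * (k : ENNReal))⁻¹ = 2⁻¹ := by
      rw [ENNReal.mul_inv (by simp) (by simp), mul_left_comm,
        ENNReal.mul_inv_cancel hk0 (ENNReal.natCast_ne_top k), mul_one]
    rw [Finset.sum_const, Finset.card_univ, Fintype.card_fin, nsmul_eq_mul, Nat.cast_mul,
      Nat.cast_ofNat, h, inv_inv]
  have hL2 : ∀ (c : Fin k → Fin n) (e : Fin k → Fin p),
      MemLp (fun ω => ∏ s, X ω (c s) (e s)) 2 P := by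
    intro c e
    have h := MemLp.prod' (s := Finset.univ) (f := fun s ω => X ω (c s) (e s))
      (p := fun _ => ((2 * k : ℕ) : ENNReal)) fun s _ => hmom (c s) (e s)
    rwa [hexp] at h
  exact (hL2 i j).integrable_mul (hL2 i' j').star

theorem commute_tensorPow_of_sum_eq {A : Matrix (Fin k → Fin n) (Fin k → Fin n) ℂ}
    {U : Matrix (Fin n) (Fin n) ℂ} (hU : U ∈ Matrix.unitaryGroup (Fin n) ℂ)
    (h : ∀ i i', A i i' = ∑ a, ∑ b, tensorPow k U i a * conj (tensorPow k U i' b) * A a b) :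
    Commute A (tensorPow k U) := by
  have h1 : A = tensorPow k U * A * tensorPow k (star U) := by
    ext i i'
    rw [h]
    simp only [Matrix.mul_apply, Finset.sum_mul]
    rw [Finset.sum_comm]
    refine Finset.sum_congr rfl fun b _ => Finset.sum_congr rfl fun a _ => ?_
    have h2 : tensorPow k (star U) b i' = conj (tensorPow k U i' b) := by
      simp [tensorPow, Matrix.star_apply]
    rw [h2]
    ring
  have h3 : A * tensorPow k U = tensorPow k U * A := by
    conv_lhs => rw [h1]
    rw [Matrix.mul_assoc, ← tensorPow_mul, Matrix.mem_unitaryGroup_iff'.1 hU, tensorPow_one,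
      Matrix.mul_one]
  exact h3

theorem commute_momentMatrix {X : Ω → Matrix (Fin n) (Fin p) ℂ}
    (hint : ∀ i i' j j', Integrable (fun ω => entryProd (k := k) i i' j j' (X ω)) P)
    (j j' : Fin k → Fin p) {U : Matrix (Fin n) (Fin n) ℂ}
    (hU : U ∈ Matrix.unitaryGroup (Fin n) ℂ)
    (hinv : IdentDistrib (fun ω => U * X ω) X P P) :
    Commute (momentMatrix P X j j') (tensorPow k U) := by
  refine commute_tensorPow_of_sum_eq hU fun i i' => ?_
  have h := (hinv.comp (measurable_entryProd i i' j j')).integral_eq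
  simp only [Function.comp_apply] at h
  rw [momentMatrix, ← h]
  simp only [entryProd_mul]
  rw [integral_finsetSum _ fun a _ => integrable_finsetSum _ fun b _ =>
    (hint a b j j').const_mul _]
  refine Finset.sum_congr rfl fun a _ => ?_
  rw [integral_finsetSum _ fun b _ => (hint a b j j').const_mul _]
  exact Finset.sum_congr rfl fun b _ => integral_const_mul _ _

theorem transpose_mem_unitaryGroup {U : Matrix (Fin n) (Fin n) ℂ}
    (hU : U ∈ Matrix.unitaryGroup (Fin n) ℂ) : U.transpose ∈ Matrix.unitaryGroup (Fin n) ℂ := by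
  rw [Matrix.mem_unitaryGroup_iff]
  have h := congrArg Matrix.transpose (Matrix.mem_unitaryGroup_iff'.1 hU)
  rwa [Matrix.transpose_mul, Matrix.transpose_one] at h

theorem sum_wg_mul_wg (z w : ℂ) (σ₁ σ₂ : Equiv.Perm (Fin k)) (I : Equiv.Perm (Fin k) → ℂ) :
    ∑ τ₁, ∑ τ₂, wg k z (σ₁⁻¹ * τ₁) * wg k w (σ₂⁻¹ * τ₂) * I (τ₂⁻¹ * τ₁) =
      ∑ π, doubleWg k z w (π * σ₁⁻¹ * σ₂) * I π := by
  have h1 : ∀ τ₂, ∑ τ₁, wg k z (σ₁⁻¹ * τ₁) * wg k w (σ₂⁻¹ * τ₂) * I (τ₂⁻¹ * τ₁)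
      = ∑ π, wg k z (π * σ₁⁻¹ * τ₂) * wg k w (τ₂⁻¹ * σ₂) * I π := by
    intro τ₂
    symm
    -- Substitution `τ₁ = τ₂π`. Centrality and invariance under inversion then give the factors the
    -- shape of a convolution in `τ₂`.
    refine Fintype.sum_equiv (Equiv.mulLeft τ₂) _ _ fun π => ?_
    have h2 : wg k z (π * σ₁⁻¹ * τ₂) = wg k z (σ₁⁻¹ * (τ₂ * π)) := by
      rw [mul_assoc, isCentral_mul_comm (wg_spec k z).1, mul_assoc]
    have h3 : wg k w (τ₂⁻¹ * σ₂) = wg k w (σ₂⁻¹ * τ₂) := by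
      rw [← wg_inv, mul_inv_rev, inv_inv]
    simp [h2, h3]
  rw [Finset.sum_comm]
  simp only [h1]
  rw [Finset.sum_comm]
  refine Finset.sum_congr rfl fun π _ => ?_
  rw [← Finset.sum_mul, doubleWg, conv]
  congr 1
  refine Fintype.sum_equiv (Equiv.mulLeft (π * σ₁⁻¹)) _ _ fun τ => ?_
  rw [Equiv.coe_mulLeft]
  congr 2
  group

end MixedMoments

/-! ### The moment formula. -/

theorem mainTheorem5 {Ω : Type*} [MeasurableSpace Ω] (P : Measure Ω) [IsProbabilityMeasure P]
    (n p k : ℕ) (hk : 0 < k)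
    (X : Ω → Matrix (Fin n) (Fin p) ℂ) (hX : AEMeasurable X P)
    (hinv : ∀ U ∈ Matrix.unitaryGroup (Fin n) ℂ, ∀ V ∈ Matrix.unitaryGroup (Fin p) ℂ,
      IdentDistrib (fun ω => U * X ω * V) X P P)
    (hmom : ∀ (a : Fin n) (b : Fin p), MemLp (fun ω => X ω a b) ((2 * k : ℕ) : ENNReal) P)
    (i i' : Fin k → Fin n) (j j' : Fin k → Fin p) :
    ∫ ω, (∏ s, X ω (i s) (j s)) * conj (∏ s, X ω (i' s) (j' s)) ∂P =
      ∑ σ₁ : Equiv.Perm (Fin k), ∑ σ₂ : Equiv.Perm (Fin k), ∑ π : Equiv.Perm (Fin k),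
        delta σ₁ i i' * delta σ₂ j j' *
          doubleWg k (n : ℂ) (p : ℂ) (π * σ₁⁻¹ * σ₂) *
          ∫ ω, trPerm π (X ω * (X ω).conjTranspose) ∂P := by
  have hint := integrable_entryProd hk hmom
  have hleft : ∀ U ∈ Matrix.unitaryGroup (Fin n) ℂ, IdentDistrib (fun ω => U * X ω) X P P := by
    intro U hU
    simpa using hinv U hU 1 (one_mem _)
  -- Transposition turns right invariance into left invariance, so the row expansion also serves for
  -- columns.
  have hright : ∀ V ∈ Matrix.unitaryGroup (Fin p) ℂ,
      IdentDistrib (fun ω => V * (X ω).transpose) (fun ω => (X ω).transpose) P P := by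
    intro V hV
    have h := (hinv 1 (one_mem _) _ (transpose_mem_unitaryGroup hV)).comp measurable_transpose
    simpa [Function.comp_def, Matrix.transpose_mul] using h
  set M : (Fin k → Fin n) → (Fin k → Fin n) → (Fin k → Fin p) → (Fin k → Fin p) → ℂ :=
    fun i i' j j' => ∫ ω, entryProd i i' j j' (X ω) ∂P with hM
  have hrow : ∀ i i' j j', M i i' j j' =
      ∑ σ, ∑ τ, delta σ i i' * wg k n (σ⁻¹ * τ) * ∑ c, M c (c ∘ τ) j j' :=
    fun i i' j j' => eq_sum_wg_delta (A := momentMatrix P X j j')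
      (fun U hU => commute_momentMatrix hint j j' hU (hleft U hU)) i i'
  have hcol : ∀ i i' j j', M i i' j j' =
      ∑ σ, ∑ τ, delta σ j j' * wg k p (σ⁻¹ * τ) * ∑ e, M i i' e (e ∘ τ) :=
    fun i i' j j' => eq_sum_wg_delta (A := momentMatrix P (fun ω => (X ω).transpose) i i')
      (fun V hV => commute_momentMatrix (X := fun ω => (X ω).transpose)
        (fun a b c d => hint c d a b) i i' hV (hright V hV)) j j'
  have htr : ∀ σ τ : Equiv.Perm (Fin k), ∑ c, ∑ e, M c (c ∘ σ) e (e ∘ τ) =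
      ∫ ω, trPerm (τ⁻¹ * σ) (X ω * (X ω).conjTranspose) ∂P := by
    intro σ τ
    simp only [← sum_entryProd_perm]
    rw [integral_finsetSum _ fun c _ => integrable_finsetSum _ fun e _ => hint _ _ _ _]
    exact Finset.sum_congr rfl fun c _ => (integral_finsetSum _ fun e _ => hint _ _ _ _).symm
  -- The column expansion is inserted into the row-traced moments, so that both index families
  -- become traced.
  have hexpand : ∀ τ₁ : Equiv.Perm (Fin k), ∑ c, M c (c ∘ τ₁) j j' =
      ∑ σ₂, ∑ τ₂, delta σ₂ j j' * wg k p (σ₂⁻¹ * τ₂) *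
        ∫ ω, trPerm (τ₂⁻¹ * τ₁) (X ω * (X ω).conjTranspose) ∂P := by
    intro τ₁
    simp only [hcol _ _ j j', ← htr, Finset.mul_sum]
    rw [Finset.sum_comm]
    refine Finset.sum_congr rfl fun σ₂ _ => ?_
    rw [Finset.sum_comm]
  change M i i' j j' = _
  rw [hrow]
  refine Finset.sum_congr rfl fun σ₁ _ => ?_
  simp only [hexpand, mul_assoc, ← Finset.mul_sum]
  simp only [← mul_assoc, ← sum_wg_mul_wg]
  simp only [Finset.mul_sum]
  rw [Finset.sum_comm]
  exact Finset.sum_congr rfl fun σ₂ _ => Finset.sum_congr rfl fun τ₁ _ =>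
    Finset.sum_congr rfl fun τ₂ _ => by ring
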